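/- Let $G$ be a finite undirected graph. In the guessing game $(G,s)$ every vertex $v$ receives a value $a_v\in\{0,\dots,s-1\}$, uniformly and independently, sees exactly the values of its neighbours, and guesses its own value; a strategy $\mathcal F$ assigns to every vertex a function from the values of its neighbours to a guess, and $\mathrm{Win}(G,s,\mathcal F)$ is the event that all guesses are correct. Put $$\mathrm{gn}(G,s)=|V(G)|+\log_s\Bigl(\max_{\mathcal F}\mathbf P[\mathrm{Win}(G,s,\mathcal F)]\Bigr),\qquad \mathrm{gn}(G)=\lim_{s\to\infty}\mathrm{gn}(G,s).$$ A fractional clique cover of $G$ is a weighting $w$ of the cliques of $G$ by numbers in $[0,1]$ such that, for every vertex $v$, the weights of the cliques containing $v$ add up to at least $1$; $\kappa_f(G)$ is the minimum total weight of such a cover, and $|V(G)|-\kappa_f(G)$ is the fractional clique cover bound of $G$. The Shannon bound $\mathrm{Sh}(G)$ is the maximum of $h(V(G))$ over all functions $h$ from the subsets of $V(G)$ to $\mathbb R$ such that, for all $X,Y,Z,A,B\subseteq V(G)$: $h(X)\ge 0$; $h(X)\le|X|$; $h(X\cup Z)+h(Y\cup Z)-h(X\cup Y\cup Z)-h(Z)\ge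 0$; and $h(A\cup B)=h(B)$ whenever $B$ contains all neighbours of every vertex of $A$. The blowup $G(t)$ has vertex set $V(G)\times\{1,\dots,t\}$, with $(u,i)$ and $(v,j)$ adjacent if and only if $uv$ is an edge of $G$. Let $R$ be the undirected graph with vertices $1,\dots,10$ and the following $27$ edges: $1$ is joined to each of $2,\dots,7$; the vertices $2,3,4,5,6,7$ form a $6$-cycle in this order; $8$ is joined to $3,4,6,7$; $9$ is joined to $2,3,5,6$; $10$ is joined to $2,4,5,7$; and $8,9,10$ are pairwise adjacent. Let $R_c$ be the $13$-vertex graph obtained from $R$ by adding clones $8',9',10'$ of $8,9,10$ (two vertices of $R_c$ are adjacent if and only if the vertices of $R$ that they are copies of are adjacent). The $R_c$ strategy over the alphabet $\mathbb Z/3$ is based on the four conditions $$\begin{aligned} (1)\quad& a_1+a_2+2a_3+a_4+2a_5+a_6+2a_7=0, & (2)\quad& a_2+a_5+a_8+a_{8'}+a_9+a_{10'}=0,\\ (3)\quad& a_3+a_6+a_8+a_{9'}+a_{10}+a_{10'}=0, & (4)\quad& a_4+a_7+a_{8'}+a_9+a_{9'}+a_{10}=0. \end{aligned}$$ Each player guesses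 the value that makes a certain linear combination of them true, namely, writing the coefficients of $(1),(2),(3),(4)$ as a vector: player $1$ uses $(1,0,0,0)$; $2$ uses $(2,2,1,1)$; $3$ uses $(1,1,2,1)$; $4$ uses $(2,1,1,2)$; $5$ uses $(1,2,1,1)$; $6$ uses $(2,1,2,1)$; $7$ uses $(1,1,1,2)$; $8$ and $9'$ use $(0,0,1,0)$; $9$ and $10'$ use $(0,1,0,0)$; $10$ and $8'$ use $(0,0,0,1)$. **Theorem.** 1. $\mathrm{gn}(R)=27/4$ (in particular the limit exists). 2. The minimum defining $\kappa_f(R)$ is attained and the fractional clique cover bound of $R$ is $20/3$; in particular it differs from $\mathrm{gn}(R)=27/4$. 3. $\mathrm{Sh}(R)=27/4$. 4. The $40$ vertices of $R(4)$ can be partitioned into nine triangles $T_1,\dots,T_9$ and a set of $13$ vertices that induces a copy of $R_c$, such that there is a strategy $\mathcal F$ for the guessing game $(R(4),3)$ in which every vertex $v$ of every $T_i$ guesses $-\sum_{u\in T_i\setminus\{v\}}a_u \bmod 3$, the remaining $13$ vertices play the $R_c$ strategy on the copy of $R_c$, and $\mathbf P[\mathrm{Win}(R(4),3,\mathcal F)]=3^{-13}$.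 -/

import Mathlib

open Filter Topology

namespace GuessingGame

/-! Guessing games on finite undirected graphs; every player sees the values of its neighbours. -/

/-- A (pure) strategy for the guessing game `(G, s)`: each player `v` guesses its own value as a
function of the values assigned to its neighbours. -/
abbrev Strategy {V : Type*} (G : SimpleGraph V) (s : ℕ) : Type _ :=
  (v : V) → (G.neighborSet v → Fin s) → Fin s

/-- The guess of player `v` under the strategy `F` when the assigned values are `a`. -/
def Strategy.guess {V : Type*} {G : SimpleGraph V} {s : ℕ} (F : Strategy G s)
    (a : V → Fin s) (v : V) : Fin s :=
  F v (fun u => a u)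

/-- The event that all players guess correctly. -/
def winSet {V : Type*} (G : SimpleGraph V) (s : ℕ) (F : Strategy G s) : Set (V → Fin s) :=
  {a | ∀ v, F.guess a v = a v}

/-- The probability of winning when the values are independent and uniform on `Fin s`. -/
noncomputable def winProb {V : Type*} [Fintype V] (G : SimpleGraph V) (s : ℕ)
    (F : Strategy G s) : ℝ :=
  ((winSet G s F).ncard : ℝ) / (s : ℝ) ^ Fintype.card V

/-- The guessing number `gn(G, s) = |V| + log_s (max_F P[Win(G, s, F)])`. There are only finitely
many strategies, and at least one if `s ≥ 1`, so that the supremum is then a maximum. -/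
noncomputable def guessingNumber {V : Type*} [Fintype V] (G : SimpleGraph V) (s : ℕ) : ℝ :=
  (Fintype.card V : ℝ) + Real.logb s (⨆ F : Strategy G s, winProb G s F)

/-- `g` is the asymptotic guessing number of `G`: the limit of `gn(G, s)` as `s → ∞` exists and
is equal to `g`. -/
def HasAsymptoticGuessingNumber {V : Type*} [Fintype V] (G : SimpleGraph V) (g : ℝ) : Prop :=
  Tendsto (fun s : ℕ => guessingNumber G s) atTop (𝓝 g)

/-- The `t`-uniform blowup of `G`. -/
def blowup {V : Type*} (G : SimpleGraph V) (t : ℕ) : SimpleGraph (V × Fin t) :=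
  G.comap Prod.fst

/-! Fractional clique covers. -/

/-- A fractional clique cover, as a function on all finite vertex sets that vanishes off the
cliques. -/
structure IsFractionalCliqueCover {V : Type*} [Fintype V] [DecidableEq V] (G : SimpleGraph V)
    (w : Finset V → ℝ) : Prop where
  mem_Icc : ∀ k, w k ∈ Set.Icc (0 : ℝ) 1
  eq_zero : ∀ k : Finset V, ¬ G.IsClique (k : Set V) → w k = 0
  covers : ∀ v, 1 ≤ ∑ k with v ∈ k, w k

/-- The total weights of the fractional clique covers of `G`. -/
def cliqueCoverWeights {V : Type*} [Fintype V] [DecidableEq V] (G : SimpleGraph V) : Set ℝ :=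
  {x | ∃ w, IsFractionalCliqueCover G w ∧ ∑ k, w k = x}

/-- The fractional clique cover number `κ_f(G)`. -/
noncomputable def fractionalCliqueCoverNumber {V : Type*} [Fintype V] [DecidableEq V]
    (G : SimpleGraph V) : ℝ :=
  sInf (cliqueCoverWeights G)

/-- The fractional clique cover bound `|V| - κ_f(G)`. -/
noncomputable def fractionalCliqueCoverBound {V : Type*} [Fintype V] [DecidableEq V]
    (G : SimpleGraph V) : ℝ :=
  (Fintype.card V : ℝ) - fractionalCliqueCoverNumber G

/-! The Shannon bound. -/

/-- The constraints of the linear program that defines the Shannon bound; `h X` stands for the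
joint entropy of the values assigned to the vertices in `X`. -/
structure IsShannonFeasible {V : Type*} [Fintype V] [DecidableEq V] (G : SimpleGraph V)
    (h : Finset V → ℝ) : Prop where
  nonneg : ∀ X, 0 ≤ h X
  le_card : ∀ X, h X ≤ X.card
  shannon : ∀ X Y Z, 0 ≤ h (X ∪ Z) + h (Y ∪ Z) - h (X ∪ Y ∪ Z) - h Z
  graph : ∀ A B : Finset V, (∀ u ∈ A, G.neighborSet u ⊆ (B : Set V)) → h (A ∪ B) = h B

/-- The values of the objective function `h V` on the feasible points; the Shannon bound `Sh(G)`
is the greatest of them. -/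
def shannonValues {V : Type*} [Fintype V] [DecidableEq V] (G : SimpleGraph V) : Set ℝ :=
  {x | ∃ h, IsShannonFeasible G h ∧ h Finset.univ = x}

/-- `x` is the Shannon bound of `G`. -/
def IsShannonBound {V : Type*} [Fintype V] [DecidableEq V] (G : SimpleGraph V) (x : ℝ) : Prop :=
  IsGreatest (shannonValues G) x

/-! The graphs `R` and `R_c`. -/

/-- The graph `R`. With vertices numbered `1, …, 10`, vertex `i` is represented by
`i - 1 : Fin 10`. The vertex `1` is joined to the hexagon `2 3 4 5 6 7`, the vertices
`8`, `9`, `10` form a triangle, and each of these sees four vertices of the hexagon. -/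
def graphR : SimpleGraph (Fin 10) :=
  SimpleGraph.fromRel fun i j => (i, j) ∈ ([
    (0, 1), (0, 2), (0, 3), (0, 4), (0, 5), (0, 6),
    (1, 2), (2, 3), (3, 4), (4, 5), (5, 6), (6, 1),
    (7, 2), (7, 3), (7, 5), (7, 6),
    (8, 1), (8, 2), (8, 4), (8, 5),
    (9, 1), (9, 3), (9, 4), (9, 6),
    (7, 8), (8, 9), (9, 7)] : List (Fin 10 × Fin 10))

/-- The vertices of `R_c` are `1, …, 10, 8', 9', 10'`, in this order; this is the map that sends
each to the vertex of `R` of which it is a copy. -/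
def cloneOf : Fin 13 → Fin 10 := ![0, 1, 2, 3, 4, 5, 6, 7, 8, 9, 7, 8, 9]

/-- The graph `R_c`, obtained from `R` by cloning the vertices `8`, `9`, `10`. -/
def graphRc : SimpleGraph (Fin 13) := graphR.comap cloneOf

/-- The four parity conditions `∑ w, rcCheck i w * a w = 0` in `ℤ/3`; the columns are
`1, 2, 3, 4, 5, 6, 7, 8, 9, 10, 8', 9', 10'`. -/
def rcCheck : Matrix (Fin 4) (Fin 13) (Fin 3) :=
  !![1, 1, 2, 1, 2, 1, 2, 0, 0, 0, 0, 0, 0;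
     0, 1, 0, 0, 1, 0, 0, 1, 1, 0, 1, 0, 1;
     0, 0, 1, 0, 0, 1, 0, 1, 0, 1, 0, 1, 1;
     0, 0, 0, 1, 0, 0, 1, 0, 1, 1, 1, 1, 0]

/-- Row `v` gives the linear combination of the four conditions that player `v` uses. -/
def rcComb : Matrix (Fin 13) (Fin 4) (Fin 3) :=
  !![1, 0, 0, 0;
     2, 2, 1, 1;
     1, 1, 2, 1;
     2, 1, 1, 2;
     1, 2, 1, 1;
     2, 1, 2, 1;
     1, 1, 1, 2;
     0, 0, 1, 0;
     0, 1, 0, 0;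
     0, 0, 0, 1;
     0, 0, 0, 1;
     0, 0, 1, 0;
     0, 1, 0, 0]

/-- The guess of player `v` in the `R_c` strategy: the combination of the conditions used by `v`
has coefficient `1` at `v`, and `v` guesses the value that makes it hold. -/
def rcGuess (a : Fin 13 → Fin 3) (v : Fin 13) : Fin 3 :=
  -∑ w with w ≠ v, (rcComb * rcCheck) v w * a w

end GuessingGame

open GuessingGame

namespace GuessingGame

/-! The winning set of a strategy is a code (`IsCode`), and every code lies in the winning set of
some strategy; hence `gn(G, s)` is `log_s` of the largest size of a code over `s` letters.
Everything below is about codes.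

Upper bound: for a uniformly random word of a code, the joint entropies in base `s` satisfy the
Shannon constraints (`IsCode.isShannonFeasible`), so `gn(G, s) ≤ Sh(G)` for all `s ≥ 2`. The bound
`Sh(R) ≤ 27/4` is linear programming duality: a feasible `h` may be averaged over the automorphisms
of `R`, and then twenty instances of submodularity suffice (`le_of_invariant`).

Lower bound: the strategy on `R(4)` wins exactly when 13 independent linear conditions over `ℤ/3`
hold, which leaves a code of size `3 ^ (40 - 13) = 3 ^ 27`. Grouping the four copies of each vertex
turns it into a code on `R` over `3 ^ 4` letters, and `log_81 (3 ^ 27) = 27/4`. Powers of this code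
embed into all large alphabets, which gives the limit; its entropy attains the Shannon bound.

The clique cover number is `10/3` because `R` has no 4-clique and its triangles cover all vertices
evenly. -/

/-- A set of assignments in which the value at each vertex is determined by the values at its
neighbours. -/
def IsCode {V α : Type*} (G : SimpleGraph V) (S : Finset (V → α)) : Prop :=
  ∀ a ∈ S, ∀ b ∈ S, ∀ v, (∀ u, G.Adj v u → a u = b u) → a v = b v

/-! ### Entropy of a uniformly random codeword -/

section Entropy

variable {V α : Type*} [DecidableEq α]

/-- The members of `S` that agree with `a` on `X`. -/
def cylinder (S : Finset (V → α)) (X : Finset V) (a : V → α) : Finset (V → α) :=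
  {b ∈ S | ∀ v ∈ X, b v = a v}

/-- The joint entropy of the coordinates in `X` of a uniformly random member of `S`. -/
noncomputable def entropy (S : Finset (V → α)) (X : Finset V) : ℝ :=
  Real.log S.card - (∑ a ∈ S, Real.log (cylinder S X a).card) / S.card

variable {S : Finset (V → α)} {X Y Z : Finset V} {a b : V → α}

theorem mem_cylinder : b ∈ cylinder S X a ↔ b ∈ S ∧ ∀ v ∈ X, b v = a v := by
  simp [cylinder]

theorem self_mem_cylinder (ha : a ∈ S) : a ∈ cylinder S X a := by
  simp [mem_cylinder, ha]

theorem card_cylinder_pos (ha : a ∈ S) : (0 : ℝ) < (cylinder S X a).card := by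
  exact_mod_cast Finset.card_pos.2 ⟨a, self_mem_cylinder ha⟩

theorem cylinder_congr (h : b ∈ cylinder S X a) : cylinder S X b = cylinder S X a := by
  ext c
  simp only [mem_cylinder] at h ⊢
  exact and_congr_right fun _ => forall₂_congr fun v hv => by rw [h.2 v hv]

/-- All of `T` lies in one cylinder, so each term is at most `1 / |T|`. -/
theorem sum_inv_card_cylinder_le_one {T : Finset (V → α)} (hT : T ⊆ S)
    (h : ∀ a ∈ T, ∀ b ∈ T, ∀ v ∈ X, b v = a v) :
    ∑ a ∈ T, ((cylinder S X a).card : ℝ)⁻¹ ≤ 1 := by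
  rcases T.eq_empty_or_nonempty with rfl | hne
  · simp
  have hpos : (0 : ℝ) < T.card := by exact_mod_cast hne.card_pos
  calc ∑ a ∈ T, ((cylinder S X a).card : ℝ)⁻¹ ≤ ∑ a ∈ T, (T.card : ℝ)⁻¹ := by
        refine Finset.sum_le_sum fun a ha => inv_anti₀ hpos ?_
        exact_mod_cast Finset.card_le_card fun b hb => mem_cylinder.2 ⟨hT hb, h a ha b hb⟩
    _ = 1 := by rw [Finset.sum_const, nsmul_eq_mul, mul_inv_cancel₀ hpos.ne']

theorem entropy_univ [Fintype V] : entropy S Finset.univ = Real.log S.card := by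
  have h : ∀ a ∈ S, cylinder S Finset.univ a = {a} := fun a ha => by
    ext b
    simp only [mem_cylinder, Finset.mem_univ, true_imp_iff, Finset.mem_singleton]
    exact ⟨fun h => funext h.2, fun h => by subst h; exact ⟨ha, fun _ => rfl⟩⟩
  rw [entropy, Finset.sum_congr rfl fun a ha => by rw [h a ha]]
  simp

theorem entropy_nonneg (hS : S.Nonempty) : 0 ≤ entropy S X := by
  have hpos : (0 : ℝ) < S.card := by exact_mod_cast hS.card_pos
  rw [entropy, sub_nonneg, div_le_iff₀ hpos, mul_comm, ← nsmul_eq_mul]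
  refine Finset.sum_le_card_nsmul _ _ _ fun a ha =>
    Real.log_le_log (card_cylinder_pos ha) ?_
  exact_mod_cast Finset.card_filter_le _ _

/-- The sum counts the patterns on `X` that occur in `S`: the words with a given pattern contribute
at most 1 together. -/
theorem sum_inv_card_cylinder_le [Fintype α] :
    ∑ a ∈ S, ((cylinder S X a).card : ℝ)⁻¹ ≤ (Fintype.card α : ℝ) ^ X.card := by
  classical
  rw [← Finset.sum_fiberwise S (fun a (v : X) => a v)]
  calc _ ≤ ∑ _c : X → α, (1 : ℝ) := by
        refine Finset.sum_le_sum fun c _ =>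
          sum_inv_card_cylinder_le_one (Finset.filter_subset _ _) fun a ha b hb v hv => ?_
        rw [Finset.mem_filter] at ha hb
        exact congrFun (hb.2.trans ha.2.symm) ⟨v, hv⟩
    _ = (Fintype.card α : ℝ) ^ X.card := by simp

theorem entropy_le [Fintype α] (hS : S.Nonempty) :
    entropy S X ≤ X.card * Real.log (Fintype.card α) := by
  have hpos : (0 : ℝ) < S.card := by exact_mod_cast hS.card_pos
  set q : ℝ := (Fintype.card α : ℝ) ^ X.card with hq
  have hq0 : 0 < q := by
    rcases X.eq_empty_or_nonempty with rfl | ⟨v, _⟩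
    · simp [hq]
    · obtain ⟨a, _⟩ := hS
      have : 0 < Fintype.card α := Fintype.card_pos_iff.2 ⟨a v⟩
      positivity
  -- Gibbs' inequality against the uniform distribution on `q` patterns, from `log x ≤ x - 1`.
  have key : ∀ a ∈ S, Real.log S.card - Real.log (cylinder S X a).card - Real.log q ≤
      S.card / q * ((cylinder S X a).card : ℝ)⁻¹ - 1 := fun a ha => by
    have hc := card_cylinder_pos (X := X) ha
    rw [← Real.log_div hpos.ne' hc.ne', ← Real.log_div (by positivity) hq0.ne']
    refine (Real.log_le_sub_one_of_pos (by positivity)).trans_eq ?_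
    field_simp
  have hsum := Finset.sum_le_sum key
  rw [Finset.sum_sub_distrib, Finset.sum_sub_distrib, Finset.sum_sub_distrib, ← Finset.mul_sum]
    at hsum
  simp only [Finset.sum_const, nsmul_eq_mul, mul_one] at hsum
  have h2 : S.card / q * ∑ a ∈ S, ((cylinder S X a).card : ℝ)⁻¹ ≤ S.card / q * q :=
    mul_le_mul_of_nonneg_left sum_inv_card_cylinder_le (by positivity)
  rw [div_mul_cancel₀ _ hq0.ne'] at h2
  rw [← Real.log_pow, ← hq, entropy, sub_le_iff_le_add, ← sub_le_iff_le_add', le_div_iff₀ hpos]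
  linarith

/-- The numerator counts pairs `(b, c)` that agree with `a` on `X ∪ Z` and on `Y ∪ Z` respectively.
For fixed `b` and `c`, all such `a` agree on `X ∪ Y ∪ Z`, so together they contribute at most `1 /
|cylinder S Z b|`, and only if `c` agrees with `b` on `Z`. Summing over `c` leaves 1 for each `b`.
-/
theorem sum_card_mul_card_div_le [Fintype V] [DecidableEq V] :
    ∑ a ∈ S, ((cylinder S (X ∪ Z) a).card * (cylinder S (Y ∪ Z) a).card : ℝ) /
      ((cylinder S (X ∪ Y ∪ Z) a).card * (cylinder S Z a).card) ≤ S.card := by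
  calc _ = ∑ a ∈ S, ∑ b ∈ S, ∑ c ∈ S,
        if b ∈ cylinder S (X ∪ Z) a ∧ c ∈ cylinder S (Y ∪ Z) a then
          ((cylinder S (X ∪ Y ∪ Z) a).card : ℝ)⁻¹ * ((cylinder S Z a).card : ℝ)⁻¹ else 0 := by
        refine Finset.sum_congr rfl fun a _ => ?_
        rw [← Finset.sum_product', ← Finset.sum_filter, Finset.sum_const, nsmul_eq_mul,
          div_eq_mul_inv, mul_inv]
        congr 1
        rw [← Nat.cast_mul, ← Finset.card_product]
        congr 2
        ext ⟨b, c⟩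
        simp only [Finset.mem_product, Finset.mem_filter, mem_cylinder]
        tauto
    _ = ∑ b ∈ S, ∑ c ∈ S, ∑ a ∈ S,
        if b ∈ cylinder S (X ∪ Z) a ∧ c ∈ cylinder S (Y ∪ Z) a then
          ((cylinder S (X ∪ Y ∪ Z) a).card : ℝ)⁻¹ * ((cylinder S Z a).card : ℝ)⁻¹ else 0 := by
        rw [Finset.sum_comm]
        exact Finset.sum_congr rfl fun b _ => Finset.sum_comm
    _ ≤ ∑ b ∈ S, ∑ c ∈ S, if c ∈ cylinder S Z b then ((cylinder S Z b).card : ℝ)⁻¹ else 0 := by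
        refine Finset.sum_le_sum fun b hb => Finset.sum_le_sum fun c hc => ?_
        rw [← Finset.sum_filter]
        set T := {a ∈ S | b ∈ cylinder S (X ∪ Z) a ∧ c ∈ cylinder S (Y ∪ Z) a} with hT
        have hTZ : ∀ a ∈ T, b ∈ cylinder S Z a ∧ c ∈ cylinder S Z a := fun a ha => by
          simp only [hT, Finset.mem_filter, mem_cylinder, Finset.mem_union] at ha ⊢
          exact ⟨⟨hb, fun v hv => ha.2.1.2 v (.inr hv)⟩, hc, fun v hv => ha.2.2.2 v (.inr hv)⟩
        split_ifs with h
        · have h1 : ∑ a ∈ T, ((cylinder S (X ∪ Y ∪ Z) a).card : ℝ)⁻¹ ≤ 1 := by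
            refine sum_inv_card_cylinder_le_one (Finset.filter_subset _ _)
              fun a ha a' ha' v hv => ?_
            simp only [hT, Finset.mem_filter, mem_cylinder, Finset.mem_union] at ha ha' hv
            rcases hv with (hv | hv) | hv
            · rw [← ha.2.1.2 v (.inl hv), ← ha'.2.1.2 v (.inl hv)]
            · rw [← ha.2.2.2 v (.inl hv), ← ha'.2.2.2 v (.inl hv)]
            · rw [← ha.2.1.2 v (.inr hv), ← ha'.2.1.2 v (.inr hv)]
          rw [Finset.sum_congr rfl fun a ha => by rw [← cylinder_congr (hTZ a ha).1],
            ← Finset.sum_mul]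
          exact mul_le_of_le_one_left (by positivity) h1
        · rw [Finset.sum_eq_zero]
          intro a ha
          refine absurd (mem_cylinder.2 ⟨hc, fun v hv => ?_⟩) h
          rw [(mem_cylinder.1 (hTZ a ha).2).2 v hv, (mem_cylinder.1 (hTZ a ha).1).2 v hv]
    _ = S.card := by
        rw [Finset.card_eq_sum_ones, Nat.cast_sum]
        refine Finset.sum_congr rfl fun b hb => ?_
        rw [← Finset.sum_filter, Finset.sum_const, nsmul_eq_mul]
        have : {c ∈ S | c ∈ cylinder S Z b} = cylinder S Z b := by
          ext c; simp only [Finset.mem_filter, mem_cylinder]; tauto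
        rw [this, mul_inv_cancel₀ (card_cylinder_pos hb).ne', Nat.cast_one]

/-- Nonnegativity of conditional mutual information: average `log x ≤ x - 1` over `S`, with `x` the
ratio in `sum_card_mul_card_div_le`. -/
theorem entropy_shannon [Fintype V] [DecidableEq V] (hS : S.Nonempty) :
    0 ≤ entropy S (X ∪ Z) + entropy S (Y ∪ Z) - entropy S (X ∪ Y ∪ Z) - entropy S Z := by
  have hpos : (0 : ℝ) < S.card := by exact_mod_cast hS.card_pos
  have key : ∀ a ∈ S, Real.log (cylinder S (X ∪ Z) a).card + Real.log (cylinder S (Y ∪ Z) a).card -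
      Real.log (cylinder S (X ∪ Y ∪ Z) a).card - Real.log (cylinder S Z a).card ≤
      ((cylinder S (X ∪ Z) a).card * (cylinder S (Y ∪ Z) a).card : ℝ) /
      ((cylinder S (X ∪ Y ∪ Z) a).card * (cylinder S Z a).card) - 1 := fun a ha => by
    have h1 := card_cylinder_pos (X := X ∪ Z) ha
    have h2 := card_cylinder_pos (X := Y ∪ Z) ha
    have h3 := card_cylinder_pos (X := X ∪ Y ∪ Z) ha
    have h4 := card_cylinder_pos (X := Z) ha
    rw [sub_sub, ← Real.log_mul h1.ne' h2.ne', ← Real.log_mul h3.ne' h4.ne',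
      ← Real.log_div (by positivity) (by positivity)]
    exact Real.log_le_sub_one_of_pos (by positivity)
  have hsum := Finset.sum_le_sum key
  simp only [Finset.sum_sub_distrib, Finset.sum_add_distrib, Finset.sum_const, nsmul_eq_mul,
    mul_one] at hsum
  have h2 := sum_card_mul_card_div_le (S := S) (X := X) (Y := Y) (Z := Z)
  have h3 : (∑ a ∈ S, Real.log (cylinder S (X ∪ Z) a).card +
      ∑ a ∈ S, Real.log (cylinder S (Y ∪ Z) a).card -
      ∑ a ∈ S, Real.log (cylinder S (X ∪ Y ∪ Z) a).card -
      ∑ a ∈ S, Real.log (cylinder S Z a).card) / S.card ≤ 0 :=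
    div_nonpos_of_nonpos_of_nonneg (by linarith) hpos.le
  simp only [sub_div, add_div] at h3
  simp only [entropy]
  linarith

theorem IsCode.isShannonFeasible {G : SimpleGraph V} [Fintype V] [DecidableEq V] [Fintype α]
    [Nontrivial α] (hG : IsCode G S) (hS : S.Nonempty) :
    IsShannonFeasible G fun X => entropy S X / Real.log (Fintype.card α) := by
  have hlog : 0 < Real.log (Fintype.card α) :=
    Real.log_pos (by exact_mod_cast Fintype.one_lt_card)
  refine ⟨fun X => div_nonneg (entropy_nonneg hS) hlog.le, fun X => ?_, fun X Y Z => ?_,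
    fun A B hAB => ?_⟩
  · rw [div_le_iff₀ hlog]
    exact entropy_le hS
  · rw [← add_div, ← sub_div, ← sub_div]
    exact div_nonneg (entropy_shannon hS) hlog.le
  -- Codewords that agree on `B` agree on `A` by the code property, so the two cylinders coincide.
  · have h : ∀ a ∈ S, cylinder S (A ∪ B) a = cylinder S B a := fun a ha => by
      ext b
      simp only [mem_cylinder, Finset.mem_union]
      refine and_congr_right fun hb => ⟨fun h v hv => h v (.inr hv), fun h v hv => ?_⟩
      exact hv.elim (fun hv => hG b hb a ha v fun u hu => h u (hAB v hv hu)) (h v)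
    simp only [entropy]
    rw [Finset.sum_congr rfl fun a ha => by rw [h a ha]]

end Entropy

/-! ### Averaging Shannon-feasible functions over automorphisms -/

section Symmetry

variable {V : Type*} [Fintype V] [DecidableEq V] {G : SimpleGraph V} {h : Finset V → ℝ}

theorem IsShannonFeasible.submodular (hh : IsShannonFeasible G h) (X Y : Finset V) :
    h (X ∪ Y) + h (X ∩ Y) ≤ h X + h Y := by
  have := hh.shannon X Y (X ∩ Y)
  rw [Finset.union_eq_left.2 Finset.inter_subset_left,
    Finset.union_eq_left.2 Finset.inter_subset_right,
    Finset.union_eq_left.2 (Finset.inter_subset_left.trans Finset.subset_union_left)] at this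
  linarith

theorem IsShannonFeasible.comp_map (hh : IsShannonFeasible G h) (g : G ≃g G) :
    IsShannonFeasible G fun X => h (X.map g.toEquiv.toEmbedding) := by
  refine ⟨fun X => hh.nonneg _, fun X => (hh.le_card _).trans_eq (by simp), fun X Y Z => ?_,
    fun A B hAB => ?_⟩
  · simp only [Finset.map_union]
    exact hh.shannon _ _ _
  · simp only [Finset.map_union]
    refine hh.graph _ _ fun u hu w hw => ?_
    obtain ⟨x, hx, rfl⟩ := Finset.mem_map.1 hu
    have hadj : G.Adj x (g.symm w) := by
      rw [← g.map_rel_iff]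
      simpa using hw
    exact Finset.mem_coe.2 (Finset.mem_map.2 ⟨g.symm w, hAB x hx hadj, by simp⟩)

theorem IsShannonFeasible.average {ι : Type*} [Fintype ι] [Nonempty ι] {f : ι → Finset V → ℝ}
    (hf : ∀ i, IsShannonFeasible G (f i)) :
    IsShannonFeasible G fun X => (∑ i, f i X) / Fintype.card ι := by
  have hpos : (0 : ℝ) < Fintype.card ι := by exact_mod_cast Fintype.card_pos
  refine ⟨fun X => div_nonneg (Finset.sum_nonneg fun i _ => (hf i).nonneg X) hpos.le,
    fun X => ?_, fun X Y Z => ?_, fun A B hAB => ?_⟩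
  · rw [div_le_iff₀ hpos, mul_comm, ← nsmul_eq_mul]
    exact Finset.sum_le_card_nsmul _ _ _ fun i _ => (hf i).le_card X
  · rw [← add_div, ← sub_div, ← sub_div, ← Finset.sum_add_distrib, ← Finset.sum_sub_distrib,
      ← Finset.sum_sub_distrib]
    exact div_nonneg (Finset.sum_nonneg fun i _ => (hf i).shannon X Y Z) hpos.le
  · rw [Finset.sum_congr rfl fun i _ => (hf i).graph A B hAB]

/-- The feasible region is convex and stable under automorphisms, which fix the full vertex set; the
group average is therefore feasible with the same objective value. -/
theorem IsShannonFeasible.exists_invariant (hh : IsShannonFeasible G h) :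
    ∃ h', IsShannonFeasible G h' ∧ h' Finset.univ = h Finset.univ ∧
      ∀ (g : G ≃g G) (X : Finset V), h' (X.map g.toEquiv.toEmbedding) = h' X := by
  have : Finite (G ≃g G) := Finite.of_injective _ RelIso.toEquiv_injective
  have := Fintype.ofFinite (G ≃g G)
  have : Nonempty (G ≃g G) := ⟨RelIso.refl _⟩
  have hpos : (0 : ℝ) < Fintype.card (G ≃g G) := by exact_mod_cast Fintype.card_pos
  refine ⟨_, IsShannonFeasible.average fun g : G ≃g G => hh.comp_map g, ?_, fun g X => ?_⟩
  · simp only [Finset.map_univ_equiv, Finset.sum_const, Finset.card_univ, nsmul_eq_mul]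
    rw [mul_div_cancel_left₀ _ hpos.ne']
  · congr 1
    refine Fintype.sum_equiv ⟨fun f => g.trans f, fun f => g.symm.trans f, fun f => ?_,
      fun f => ?_⟩ _ _ fun f => ?_
    · ext x; simp
    · ext x; simp
    · rw [Finset.map_map]
      rfl

variable [DecidableRel G.Adj]

/-- The set `X` together with all the vertices whose neighbours lie in `X`. -/
def seen (G : SimpleGraph V) [DecidableRel G.Adj] (X : Finset V) : Finset V :=
  Finset.univ.filter (fun u => ∀ v, G.Adj u v → v ∈ X) ∪ X

theorem IsShannonFeasible.map_seen (hh : IsShannonFeasible G h) (X : Finset V) :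
    h (seen G X) = h X :=
  hh.graph _ _ fun _ hu v hv => (Finset.mem_filter.1 hu).2 v hv

end Symmetry

/-! ### The Shannon upper bound for `R` -/

/-- The neighbourhoods in `R` as binary numbers. -/
def maskR : Fin 10 → ℕ := ![126, 837, 395, 661, 809, 465, 675, 876, 694, 474]

/-- A bit test keeps the later kernel evaluations cheap; agreement with the edge list is checked
once, here. -/
instance : DecidableRel graphR.Adj := fun i j =>
  decidable_of_iff ((maskR i).testBit j) <| by
    revert i j
    unfold graphR
    simp only [SimpleGraph.fromRel_adj]
    decide +kernel

/-- The automorphism of `R` that rotates the hexagon. -/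
def rotationR : graphR ≃g graphR where
  toFun := ![0, 2, 3, 4, 5, 6, 1, 9, 7, 8]
  invFun := ![0, 6, 1, 2, 3, 4, 5, 8, 9, 7]
  left_inv := by decide
  right_inv := by decide
  map_rel_iff' := by decide +kernel +revert

/-- The automorphism of `R` that reflects the hexagon and fixes the vertex `2`. -/
def reflectionR : graphR ≃g graphR where
  toFun := ![0, 1, 6, 5, 4, 3, 2, 7, 9, 8]
  invFun := ![0, 1, 6, 5, 4, 3, 2, 7, 9, 8]
  left_inv := by decide
  right_inv := by decide
  map_rel_iff' := by decide +kernel +revert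

/-- Two sets of vertices of `R` are alike if an automorphism takes one to a set that determines the
same vertices as the other. -/
def Alike (X Y : Finset (Fin 10)) : Prop :=
  ∃ i : Fin 6, ∃ A ∈ [X, X.map reflectionR.toEquiv.toEmbedding],
    seen graphR (seen graphR ((Finset.map rotationR.toEquiv.toEmbedding)^[i] A)) =
      seen graphR (seen graphR Y)

instance : DecidableRel Alike := fun X Y => by
  unfold Alike
  infer_instance

section ShannonUpperBound

variable {h : Finset (Fin 10) → ℝ} (hh : IsShannonFeasible graphR h)
  (hinv : ∀ (g : graphR ≃g graphR) (X : Finset (Fin 10)), h (X.map g.toEquiv.toEmbedding) = h X)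

include hh hinv

/-- An invariant `h` does not see rotations and reflections, and `seen` preserves `h`. Two rounds of
`seen` are used because a vertex determined in the first round may determine others. -/
theorem eq_of_alike {X Y : Finset (Fin 10)} (hXY : Alike X Y) : h X = h Y := by
  have hrot : ∀ (n : ℕ) (A : Finset (Fin 10)),
      h ((Finset.map rotationR.toEquiv.toEmbedding)^[n] A) = h A := fun n => by
    induction n with
    | zero => exact fun _ => rfl
    | succ n ih => exact fun A => by rw [Function.iterate_succ_apply, ih, hinv]
  obtain ⟨i, A, hA, hAY⟩ := hXY
  have hAX : h A = h X := by
    rcases List.mem_cons.1 hA with rfl | hA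
    · rfl
    · rw [List.mem_singleton.1 hA, hinv]
  rw [← hAX, ← hrot i, ← hh.map_seen, ← hh.map_seen, hAY, hh.map_seen, hh.map_seen]

/-- Rewrites an instance of submodularity in terms of chosen representatives, so that few distinct
values of `h` occur in the final linear program. -/
theorem submodular_of_alike (X Y X' Y' U I : Finset (Fin 10))
    (hX : Alike X X' ∧ Alike Y Y' ∧ Alike (X ∪ Y) U ∧ Alike (X ∩ Y) I) :
    h U + h I ≤ h X' + h Y' := by
  obtain ⟨h1, h2, h3, h4⟩ := hX
  rw [← eq_of_alike hh hinv h1, ← eq_of_alike hh hinv h2, ← eq_of_alike hh hinv h3,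
    ← eq_of_alike hh hinv h4]
  exact hh.submodular X Y

theorem le_of_invariant : h Finset.univ ≤ 27 / 4 := by
  have sub := submodular_of_alike hh hinv
  have h1 := sub {0} {1, 7}
    {0} {1, 7} {0, 1, 7} ∅ (by decide +kernel)
  have h2 := sub {1} {2, 3}
    {1} {1, 2} {1, 2, 3} ∅ (by decide +kernel)
  have h3 := sub {1} {0, 3, 4}
    {1} {0, 1, 2} {0, 1, 2, 4} ∅ (by decide +kernel)
  have h4 := sub {1} {2, 3, 6}
    {1} {1, 2, 4} {1, 2, 3, 4} ∅ (by decide +kernel)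
  have h5 := sub {1} {7}
    {1} {7} {1, 7} ∅ (by decide +kernel)
  have h6 := sub {1} {6, 8}
    {1} {1, 7} {1, 2, 7} ∅ (by decide +kernel)
  have h7 := sub {1} {0, 3, 4, 5, 7, 8}
    {1} {0, 2, 3, 4, 7, 8} {0, 1, 2, 3, 4, 5, 7, 8} ∅ (by decide +kernel)
  have h8 := sub {1, 2} {3, 4, 5}
    {1, 2} {1, 2, 3} {1, 2, 3, 4, 5} ∅ (by decide +kernel)
  have h9 := sub {0, 1, 2, 4} {1, 2, 7}
    {0, 1, 2, 4} {1, 2, 7} {0, 1, 2, 4, 7} {1, 2} (by decide +kernel)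
  have h10 := sub {1, 2, 3, 4} {1, 2, 4, 5, 6}
    {1, 2, 3, 4} {1, 2, 3, 4, 5} {0, 1, 2, 3, 4, 5, 6} {1, 2, 4} (by decide +kernel)
  have h11 := sub {0, 1, 2, 3, 4, 5} {0, 2, 3, 7}
    {0, 1, 2, 3, 4, 5} {0, 2, 3, 7} {0, 1, 2, 3, 4, 5, 7} {0, 1, 2} (by decide +kernel)
  have h12 := sub {0, 1, 2, 3, 4, 5, 6} {0, 1, 2, 3, 5, 6, 7}
    {0, 1, 2, 3, 4, 5, 6} {0, 1, 2, 3, 5, 6, 7} {0, 1, 2, 3, 4, 5, 6, 7} {0, 1, 2, 3, 4, 5} (by decide +kernel)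
  have h13 := sub {1, 7} {0, 3, 8}
    {1, 7} {0, 1, 7} {0, 1, 2, 3, 7, 8} ∅ (by decide +kernel)
  have h14 := sub {1, 2, 7} {0, 1, 2, 5, 9}
    {1, 2, 7} {0, 1, 2, 4, 7} {0, 1, 2, 3, 4, 7, 8} {1, 2} (by decide +kernel)
  have h15 := sub {0, 1, 2, 3, 7} {0, 1, 5, 6, 7}
    {0, 1, 2, 3, 7} {0, 1, 2, 3, 7} {0, 1, 2, 3, 5, 6, 7} {0, 1, 7} (by decide +kernel)
  have h16 := sub {0, 2, 3, 4, 5, 7} {0, 2, 3, 4, 7, 9}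
    {0, 2, 3, 4, 5, 7} {0, 1, 2, 3, 7, 8} {0, 1, 2, 3, 4, 7, 8} {0, 1, 2, 3, 7} (by decide +kernel)
  have h17 := sub {0, 1, 2, 3, 4, 5, 7} {0, 2, 3, 4, 5, 7, 9}
    {0, 1, 2, 3, 4, 5, 7} {0, 1, 2, 3, 4, 7, 8} .univ {0, 2, 3, 4, 5, 7} (by decide +kernel)
  have h18 := sub {0, 1, 2, 3, 4, 5, 6, 7} {0, 1, 2, 3, 4, 5, 7, 8}
    {0, 1, 2, 3, 4, 5, 6, 7} {0, 1, 2, 3, 4, 5, 7, 8} .univ {0, 1, 2, 3, 4, 5, 7} (by decide +kernel)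
  have h19 := sub {0, 1, 2, 3, 7, 8} {0, 2, 3, 4, 7, 9}
    {0, 1, 2, 3, 7, 8} {0, 1, 2, 3, 7, 8} {0, 1, 2, 3, 4, 7, 8, 9} {0, 2, 3, 7} (by decide +kernel)
  have h20 := sub {0, 1, 2, 3, 4, 7, 8} {0, 2, 3, 4, 5, 7, 8, 9}
    {0, 1, 2, 3, 4, 7, 8} {0, 1, 2, 3, 4, 7, 8, 9} .univ {0, 2, 3, 4, 7, 8} (by decide +kernel)
  -- One vertex from each orbit: the hub, the hexagon and the triangle `8 9 10`. With these bounds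
  -- the twenty inequalities above form a dual certificate.
  have c0 := hh.le_card {0}
  have c1 := hh.le_card {1}
  have c7 := hh.le_card {7}
  have h0 := hh.nonneg ∅
  rw [Finset.card_singleton, Nat.cast_one] at c0 c1 c7
  linarith

end ShannonUpperBound

theorem shannonValues_graphR_le {x : ℝ} (hx : x ∈ shannonValues graphR) : x ≤ 27 / 4 := by
  obtain ⟨h, hh, rfl⟩ := hx
  obtain ⟨h', hh', huniv, hinv⟩ := hh.exists_invariant
  rw [← huniv]
  exact le_of_invariant hh' hinv

/-! ### The fractional clique cover number of `R` -/

theorem card_le_three_of_isClique_graphR {k : Finset (Fin 10)} (hk : graphR.IsClique (k : Set _)) :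
    k.card ≤ 3 := by
  have hfree : graphR.CliqueFree 4 := by
    have h : ∀ a b, graphR.Adj a b → ∀ c, graphR.Adj a c → graphR.Adj b c →
        ∀ d, graphR.Adj a d → graphR.Adj b d → ¬ graphR.Adj c d := by
      decide +kernel
    by_contra hfree
    obtain ⟨f⟩ := SimpleGraph.not_cliqueFree_iff_top_isContained 4 |>.1 hfree
    have hf : ∀ i j : Fin 4, i ≠ j → graphR.Adj (f i) (f j) := fun i j hij => f.toHom.map_adj hij
    exact h _ _ (hf 0 1 (by decide)) _ (hf 0 2 (by decide)) (hf 1 2 (by decide)) _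
      (hf 0 3 (by decide)) (hf 1 3 (by decide)) (hf 2 3 (by decide))
  by_contra! h
  obtain ⟨s, hsk, hs⟩ := Finset.exists_subset_card_eq (show 4 ≤ k.card from h)
  exact hfree s ⟨hk.subset (Finset.coe_subset.2 hsk), hs⟩

/-- The triangles that consist of the vertex `1` and an edge of the hexagon. -/
def hubTriangles : Finset (Finset (Fin 10)) :=
  {{0, 1, 2}, {0, 2, 3}, {0, 3, 4}, {0, 4, 5}, {0, 5, 6}, {0, 1, 6}}

/-- The triangle `8 9 10` and six triangles that consist of one of its vertices and an edge of the
hexagon. -/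
def rimTriangles : Finset (Finset (Fin 10)) :=
  {{7, 8, 9}, {2, 3, 7}, {5, 6, 7}, {1, 2, 8}, {4, 5, 8}, {3, 4, 9}, {1, 6, 9}}

/-- A fractional clique cover of `R` of total weight `10/3`. -/
noncomputable def coverR (k : Finset (Fin 10)) : ℝ :=
  (if k ∈ hubTriangles then 1 / 6 else 0) + (if k ∈ rimTriangles then 1 / 3 else 0)

theorem sum_coverR (p : Finset (Fin 10) → Prop) [DecidablePred p] :
    ∑ k with p k, coverR k =
      (hubTriangles.filter p).card * (1 / 6) + (rimTriangles.filter p).card * (1 / 3) := by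
  simp only [coverR, Finset.sum_add_distrib, Finset.sum_ite_mem, Finset.sum_const, nsmul_eq_mul]
  congr 4 <;> ext <;> simp [and_comm]

/-- Each vertex receives exactly 1: the hub `6 · 1/6`, a hexagon vertex `2 · 1/6 + 2 · 1/3`, a
vertex of `8 9 10` `3 · 1/3`. -/
theorem isFractionalCliqueCover_coverR : IsFractionalCliqueCover graphR coverR := by
  refine ⟨fun k => ?_, fun k hk => ?_, fun v => ?_⟩
  · unfold coverR
    constructor <;> split_ifs <;> norm_num
  · have h : ∀ k ∈ hubTriangles ∪ rimTriangles, ∀ a ∈ k, ∀ b ∈ k, a ≠ b → graphR.Adj a b := by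
      decide +kernel
    have hk' : k ∉ hubTriangles ∪ rimTriangles := fun hmem => hk fun a ha b hb => h k hmem a ha b hb
    rw [Finset.mem_union, not_or] at hk'
    simp [coverR, hk'.1, hk'.2]
  · have h : ∀ v, 6 ≤ (hubTriangles.filter (v ∈ ·)).card + 2 * (rimTriangles.filter (v ∈ ·)).card := by
      decide +kernel
    have h' : (6 : ℝ) ≤ (hubTriangles.filter (v ∈ ·)).card +
      2 * (rimTriangles.filter (v ∈ ·)).card := by exact_mod_cast h v
    rw [sum_coverR]
    linarith

theorem isLeast_cliqueCoverWeights_graphR : IsLeast (cliqueCoverWeights graphR) (10 / 3) := by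
  refine ⟨⟨coverR, isFractionalCliqueCover_coverR, ?_⟩, ?_⟩
  · have h1 : hubTriangles.card = 6 := by decide +kernel
    have h2 : rimTriangles.card = 7 := by decide +kernel
    have h := sum_coverR fun _ => True
    simp only [Finset.filter_true, h1, h2] at h
    rw [h]
    norm_num
  -- Double counting: the ten covering conditions add up to at least 10, and each clique is counted
  -- at most three times.
  · rintro x ⟨w, hw, rfl⟩
    have h1 : (10 : ℝ) ≤ ∑ v : Fin 10, ∑ k with v ∈ k, w k := by
      simpa using Finset.card_nsmul_le_sum Finset.univ _ (1 : ℝ) fun v _ => hw.covers v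
    have h2 : ∑ v : Fin 10, ∑ k with v ∈ k, w k = ∑ k, (k.card : ℝ) * w k := by
      simp only [Finset.sum_filter]
      rw [Finset.sum_comm]
      refine Finset.sum_congr rfl fun k _ => ?_
      rw [Finset.sum_ite_mem, Finset.univ_inter, Finset.sum_const, nsmul_eq_mul]
    have h3 : ∑ k, (k.card : ℝ) * w k ≤ ∑ k, 3 * w k := by
      refine Finset.sum_le_sum fun k _ => ?_
      by_cases hk : graphR.IsClique (k : Set _)
      · exact mul_le_mul_of_nonneg_right
          (by exact_mod_cast card_le_three_of_isClique_graphR hk) (hw.mem_Icc k).1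
      · simp [hw.eq_zero k hk]
    rw [← Finset.mul_sum] at h3
    linarith

theorem fractionalCliqueCoverNumber_graphR : fractionalCliqueCoverNumber graphR = 10 / 3 :=
  isLeast_cliqueCoverWeights_graphR.csInf_eq

/-! ### Codes, strategies and the limit of guessing numbers -/

section Codes

variable {V α β : Type*} {G : SimpleGraph V}

theorem exists_strategy_guess_eq {s : ℕ} [NeZero s] (g : (V → Fin s) → V → Fin s)
    (hg : ∀ a b v, (∀ u, G.Adj v u → a u = b u) → g a v = g b v) :
    ∃ F : Strategy G s, ∀ a v, F.guess a v = g a v := by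
  classical
  -- The padding by 0 is harmless, since `g` at `v` depends on the neighbours of `v` only.
  refine ⟨fun v b => g (fun u => if h : G.Adj v u then b ⟨u, h⟩ else 0) v, fun a v => ?_⟩
  exact hg _ _ v fun u hu => by simp [hu]

theorem isCode_winSet {s : ℕ} (F : Strategy G s) {S : Finset (V → Fin s)}
    (hS : (S : Set (V → Fin s)) ⊆ winSet G s F) : IsCode G S := by
  intro a ha b hb v h
  rw [← hS ha v, ← hS hb v]
  exact congrArg (F v) (funext fun u => h u u.2)

/-- Each player picks some codeword consistent with what it sees and guesses that word's value. The
choice depends on the visible values only, because `epsilon` is applied to equal predicates. -/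
theorem IsCode.exists_subset_winSet {s : ℕ} [NeZero s] {S : Finset (V → Fin s)} (hS : IsCode G S) :
    ∃ F : Strategy G s, (S : Set (V → Fin s)) ⊆ winSet G s F := by
  obtain ⟨F, hF⟩ := exists_strategy_guess_eq (G := G) (s := s)
    (fun a v => Classical.epsilon (fun b => b ∈ S ∧ ∀ u, G.Adj v u → b u = a u) v)
    fun a b v hab => by
      have : ∀ c : V → Fin s, (∀ u, G.Adj v u → c u = a u) ↔ (∀ u, G.Adj v u → c u = b u) :=
        fun c => forall₂_congr fun u hu => by rw [hab u hu]
      simp only [this]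
  refine ⟨F, fun a ha v => ?_⟩
  have h := Classical.epsilon_spec (p := fun b => b ∈ S ∧ ∀ u, G.Adj v u → b u = a u)
    ⟨a, ha, fun _ _ => rfl⟩
  rw [hF]
  exact hS _ h.1 _ ha v h.2

theorem IsCode.exists_embedding {S : Finset (V → α)} (hS : IsCode G S) (e : α ↪ β) :
    ∃ S' : Finset (V → β), IsCode G S' ∧ S'.card = S.card := by
  refine ⟨S.map (e.arrowCongrRight), ?_, Finset.card_map _⟩
  simp only [IsCode, Finset.mem_map]
  rintro _ ⟨a, ha, rfl⟩ _ ⟨b, hb, rfl⟩ v h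
  exact congrArg e (hS a ha b hb v fun u hu => e.injective (h u hu))

theorem IsCode.exists_power {S : Finset (V → α)} (hS : IsCode G S) (k : ℕ) :
    ∃ S' : Finset (V → Fin k → α), IsCode G S' ∧ S'.card = S.card ^ k := by
  classical
  refine ⟨(Fintype.piFinset fun _ : Fin k => S).map (Equiv.piComm _).toEmbedding, ?_, by simp⟩
  simp only [IsCode, Finset.mem_map, Fintype.mem_piFinset]
  rintro _ ⟨a, ha, rfl⟩ _ ⟨b, hb, rfl⟩ v h
  exact funext fun i => hS _ (ha i) _ (hb i) v fun u hu => congrFun (h u hu) i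

/-- Every copy of `v` sees all copies of all neighbours of `v`, so the `t` letters at `v` can be
merged into one. -/
theorem IsCode.exists_of_blowup {t : ℕ} {S : Finset (V × Fin t → α)} (hS : IsCode (blowup G t) S) :
    ∃ S' : Finset (V → Fin t → α), IsCode G S' ∧ S'.card = S.card := by
  refine ⟨S.map (Equiv.curry _ _ _).toEmbedding, ?_, Finset.card_map _⟩
  simp only [IsCode, Finset.mem_map]
  rintro _ ⟨a, ha, rfl⟩ _ ⟨b, hb, rfl⟩ v h
  exact funext fun i => hS _ ha _ hb (v, i) fun u hu => congrFun (h u.1 hu) u.2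

variable [Fintype V]

theorem add_logb_winProb {s : ℕ} (hs : 2 ≤ s) {F : Strategy G s} (hF : (winSet G s F).Nonempty) :
    (Fintype.card V : ℝ) + Real.logb s (winProb G s F) = Real.logb s (winSet G s F).ncard := by
  have hs' : (1 : ℝ) < s := by exact_mod_cast hs
  have hpos : (0 : ℝ) < (winSet G s F).ncard := by
    exact_mod_cast (Set.ncard_pos (Set.toFinite _)).2 hF
  rw [winProb, Real.logb_div hpos.ne' (by positivity), Real.logb_pow, Real.logb_self_eq_one hs']
  ring

theorem winProb_pos {s : ℕ} (hs : 2 ≤ s) {F : Strategy G s} :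
    0 < winProb G s F ↔ (winSet G s F).Nonempty := by
  have hs' : (0 : ℝ) < (s : ℝ) ^ Fintype.card V := by positivity
  rw [winProb, div_pos_iff_of_pos_right hs', Nat.cast_pos, Set.ncard_pos (Set.toFinite _)]

theorem IsCode.logb_card_le_guessingNumber {s : ℕ} (hs : 2 ≤ s) {S : Finset (V → Fin s)}
    (hS : IsCode G S) (hne : S.Nonempty) : Real.logb s S.card ≤ guessingNumber G s := by
  have : NeZero s := ⟨by omega⟩
  have hs' : (1 : ℝ) < s := by exact_mod_cast hs
  obtain ⟨F, hF⟩ := hS.exists_subset_winSet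
  have hne' : (winSet G s F).Nonempty := Set.Nonempty.mono hF hne
  have hcard : (S.card : ℝ) ≤ (winSet G s F).ncard := by
    rw [← Set.ncard_coe_finset]
    exact_mod_cast Set.ncard_le_ncard hF (Set.toFinite _)
  refine (Real.logb_le_logb_of_le hs' (by exact_mod_cast hne.card_pos) hcard).trans ?_
  rw [← add_logb_winProb hs hne', guessingNumber]
  have : Finite (Strategy G s) := by unfold Strategy; infer_instance
  gcongr
  · exact (winProb_pos hs).2 hne'
  · exact le_ciSup (Set.finite_range _).bddAbove F

theorem exists_isCode_guessingNumber_eq {s : ℕ} (hs : 2 ≤ s) (G : SimpleGraph V) :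
    ∃ S : Finset (V → Fin s), IsCode G S ∧ S.Nonempty ∧ guessingNumber G s = Real.logb s S.card := by
  have : NeZero s := ⟨by omega⟩
  have : Finite (Strategy G s) := by unfold Strategy; infer_instance
  obtain ⟨F, hF⟩ := exists_eq_ciSup_of_finite (f := winProb G s)
  have hne : (winSet G s F).Nonempty := by
    rw [← winProb_pos hs, hF]
    -- The constant strategy 0 wins on the zero assignment, so the maximum is positive and its
    -- logarithm is meaningful.
    refine lt_of_lt_of_le ((winProb_pos (F := fun _ _ => 0) hs).2 ⟨fun _ => 0, fun _ => rfl⟩)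
      (le_ciSup (Set.finite_range (winProb G s)).bddAbove _)
  refine ⟨(Set.toFinite (winSet G s F)).toFinset, isCode_winSet F (by simp), by simpa using hne, ?_⟩
  rw [guessingNumber, ← hF, add_logb_winProb hs hne, Set.ncard_eq_toFinset_card _ (Set.toFinite _)]

theorem guessingNumber_mem_shannonValues [DecidableEq V] {s : ℕ} (hs : 2 ≤ s) (G : SimpleGraph V) :
    guessingNumber G s ∈ shannonValues G := by
  obtain ⟨S, hS, hne, h⟩ := exists_isCode_guessingNumber_eq hs G
  have : Nontrivial (Fin s) := Fin.nontrivial_iff_two_le.2 hs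
  refine ⟨_, hS.isShannonFeasible hne, ?_⟩
  rw [h]
  simp only [entropy_univ, Fintype.card_fin, Real.log_div_log]

/-- A code over an alphabet `α` bounds the guessing numbers over all large alphabets. -/
theorem IsCode.mul_le_guessingNumber [Fintype α] {S : Finset (V → α)} (hS : IsCode G S)
    (hne : S.Nonempty) {s : ℕ} (hs : 2 ≤ s) (hα : 2 ≤ Fintype.card α) :
    (1 - Real.logb s (Fintype.card α)) * Real.logb (Fintype.card α) S.card ≤
      guessingNumber G s := by
  set q := Fintype.card α with hq
  have hs' : (1 : ℝ) < s := by exact_mod_cast hs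
  have hq' : (1 : ℝ) < q := by exact_mod_cast hα
  have hlogs := Real.log_pos hs'
  have hlogq := Real.log_pos hq'
  have hcard : (1 : ℝ) ≤ S.card := by exact_mod_cast hne.card_pos
  -- The exponent `k = ⌊log_q s⌋` is the largest with `q ^ k ≤ s`. The loss from `k + 1 ≥ log_q s`
  -- is the factor `1 - log_s q`, which tends to 1.
  obtain ⟨S₁, h1, hc1⟩ := hS.exists_power (Nat.log q s)
  have hle : Fintype.card (Fin (Nat.log q s) → α) ≤ Fintype.card (Fin s) := by
    simpa using Nat.pow_log_le_self q (by omega)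
  obtain ⟨S₂, h2, hc2⟩ := h1.exists_embedding (Function.Embedding.nonempty_of_card_le hle).some
  have hne2 : S₂.Nonempty := by
    rw [← Finset.card_pos, hc2, hc1]
    exact pow_pos hne.card_pos _
  refine le_trans ?_ (h2.logb_card_le_guessingNumber hs hne2)
  rw [hc2, hc1, Nat.cast_pow, Real.logb_pow]
  have hk : Real.log s ≤ (Nat.log q s + 1) * Real.log q := by
    have h : (s : ℝ) ≤ (q : ℝ) ^ (Nat.log q s + 1) := by
      exact_mod_cast (Nat.lt_pow_succ_log_self (by omega) s).le
    have := Real.log_le_log (by positivity) h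
    rwa [Real.log_pow, Nat.cast_add, Nat.cast_one] at this
  rw [← Real.logb_self_eq_one hs']
  simp only [← Real.log_div_log]
  rw [← sub_div, div_mul_div_comm, mul_div_assoc', div_le_div_iff₀ (by positivity) hlogs]
  have := mul_le_mul_of_nonneg_right (sub_le_iff_le_add.2 (hk.trans_eq (add_one_mul _ _)))
    (mul_nonneg (Real.log_nonneg hcard) hlogs.le)
  linarith

theorem IsCode.hasAsymptoticGuessingNumber [DecidableEq V] [Fintype α] {S : Finset (V → α)}
    (hS : IsCode G S) (hne : S.Nonempty) (hα : 2 ≤ Fintype.card α)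
    (hG : ∀ x ∈ shannonValues G, x ≤ Real.logb (Fintype.card α) S.card) :
    HasAsymptoticGuessingNumber G (Real.logb (Fintype.card α) S.card) := by
  have hlim : Tendsto (fun s : ℕ => (1 - Real.logb s (Fintype.card α)) *
      Real.logb (Fintype.card α) S.card) atTop (𝓝 ((1 - 0) * Real.logb (Fintype.card α) S.card)) := by
    refine Tendsto.mul_const _ (Tendsto.const_sub _ ?_)
    simp only [← Real.log_div_log]
    exact Tendsto.const_div_atTop (Real.tendsto_log_atTop.comp tendsto_natCast_atTop_atTop) _
  rw [sub_zero, one_mul] at hlim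
  refine tendsto_of_tendsto_of_tendsto_of_le_of_le' hlim tendsto_const_nhds ?_ ?_
  · filter_upwards [eventually_ge_atTop 2] with s hs
    exact hS.mul_le_guessingNumber hne hs hα
  · filter_upwards [eventually_ge_atTop 2] with s hs
    exact hG _ (guessingNumber_mem_shannonValues hs G)

theorem IsCode.isShannonBound [DecidableEq V] [Fintype α] {S : Finset (V → α)}
    (hS : IsCode G S) (hne : S.Nonempty) (hα : 2 ≤ Fintype.card α)
    (hG : ∀ x ∈ shannonValues G, x ≤ Real.logb (Fintype.card α) S.card) :
    IsShannonBound G (Real.logb (Fintype.card α) S.card) := by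
  classical
  have : Nontrivial α := Fintype.one_lt_card_iff_nontrivial.1 hα
  refine ⟨⟨_, hS.isShannonFeasible hne, ?_⟩, hG⟩
  simp only [entropy_univ, Real.log_div_log]

end Codes

/-! ### The linear strategy on `R(4)` over `ℤ/3` -/

open scoped Fin.CommRing

/-- The part of the vertex `(v, i)` of `R(4)`: one of nine triangles, or a vertex of `R_c`. -/
def part (x : Fin 10 × Fin 4) : Fin 9 ⊕ Fin 13 :=
  (![![.inr 0, .inl 0, .inl 1, .inl 2],
     ![.inr 1, .inl 0, .inl 5, .inl 8],
     ![.inr 2, .inl 0, .inl 3, .inl 5],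
     ![.inr 3, .inl 1, .inl 3, .inl 7],
     ![.inr 4, .inl 1, .inl 6, .inl 7],
     ![.inr 5, .inl 2, .inl 4, .inl 6],
     ![.inr 6, .inl 2, .inl 4, .inl 8],
     ![.inr 7, .inr 10, .inl 3, .inl 4],
     ![.inr 8, .inr 11, .inl 5, .inl 6],
     ![.inr 9, .inr 12, .inl 7, .inl 8]] : Fin 10 → Fin 4 → Fin 9 ⊕ Fin 13) x.1 x.2

/-- The triangles of the partition. -/
def triangle (i : Fin 9) : Finset (Fin 10 × Fin 4) := {x | part x = .inl i}

theorem mem_triangle {i : Fin 9} {x : Fin 10 × Fin 4} : x ∈ triangle i ↔ part x = .inl i := by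
  simp [triangle]

instance : DecidableRel (blowup graphR 4).Adj := fun x y =>
  inferInstanceAs (Decidable (graphR.Adj x.1 y.1))

theorem triangle_adj : ∀ i, ∀ x ∈ triangle i, ∀ y ∈ triangle i, x ≠ y →
    (blowup graphR 4).Adj x y := by
  decide +kernel

theorem isNClique_triangle (i : Fin 9) : (blowup graphR 4).IsNClique 3 (triangle i) := by
  refine ⟨fun x hx y hy => triangle_adj i x hx y hy, ?_⟩
  revert i
  decide +kernel

/-- The copy of `R_c` in `R(4)`. -/
def copyRc : graphRc ↪g blowup graphR 4 where
  toFun v := (cloneOf v, if v < 10 then 0 else 1)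
  inj' := by decide
  map_rel_iff' := Iff.rfl

theorem part_copyRc : ∀ v, part (copyRc v) = .inr v := by decide +kernel

theorem part_eq_inr_iff : ∀ x v, part x = .inr v ↔ copyRc v = x := by decide +kernel

/-- This makes the `R_c` strategy legal: the combination used by a player involves only its own
value and those it sees. -/
theorem rcComb_mul_rcCheck_apply_of_not_adj :
    ∀ v w, w ≠ v → ¬ graphR.Adj (cloneOf v) (cloneOf w) → (rcComb * rcCheck) v w = 0 := by
  decide +kernel

theorem rcComb_mul_rcCheck_apply_self : ∀ v, (rcComb * rcCheck) v v = 1 := by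
  decide +kernel

theorem rcGuess_eq_iff (b : Fin 13 → Fin 3) (v : Fin 13) :
    rcGuess b v = b v ↔ (rcComb.mulVec (rcCheck.mulVec b)) v = 0 := by
  rw [Matrix.mulVec_mulVec, Matrix.mulVec, dotProduct,
    ← Finset.add_sum_erase _ _ (Finset.mem_univ v), rcComb_mul_rcCheck_apply_self, one_mul, rcGuess,
    Finset.filter_ne', neg_eq_iff_add_eq_zero, add_comm]

theorem forall_rcGuess_eq_iff (b : Fin 13 → Fin 3) :
    (∀ v, rcGuess b v = b v) ↔ rcCheck.mulVec b = 0 := by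
  simp only [rcGuess_eq_iff]
  refine ⟨fun h => ?_, fun h v => by rw [h, Matrix.mulVec_zero, Pi.zero_apply]⟩
  -- Players `1`, `9`, `8`, `10` use one condition each, so their correct guesses already force all
  -- four conditions.
  have key : rcComb.submatrix (![0, 8, 7, 9] : Fin 4 → Fin 13) id = 1 := by decide +kernel
  funext j
  have hv : rcComb ((![0, 8, 7, 9] : Fin 4 → Fin 13) j) = Pi.single j 1 :=
    (congrFun key j).trans (funext fun _ => Matrix.one_eq_pi_single)
  have := h (![0, 8, 7, 9] j)
  rwa [Matrix.mulVec, hv, single_one_dotProduct] at this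

/-- The guesses on `R(4)`. -/
def guessR (a : Fin 10 × Fin 4 → Fin 3) (x : Fin 10 × Fin 4) : Fin 3 :=
  match part x with
  | .inl i => -∑ u ∈ (triangle i).erase x, a u
  | .inr v => rcGuess (a ∘ copyRc) v

theorem guessR_triangle {a : Fin 10 × Fin 4 → Fin 3} {i : Fin 9} {x : Fin 10 × Fin 4}
    (hx : x ∈ triangle i) : guessR a x = -∑ u ∈ (triangle i).erase x, a u := by
  rw [guessR, mem_triangle.1 hx]

theorem guessR_copyRc (a : Fin 10 × Fin 4 → Fin 3) (v : Fin 13) :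
    guessR a (copyRc v) = rcGuess (a ∘ copyRc) v := by
  rw [guessR, part_copyRc]

theorem guessR_congr (a b : Fin 10 × Fin 4 → Fin 3) (x : Fin 10 × Fin 4)
    (h : ∀ u, (blowup graphR 4).Adj x u → a u = b u) : guessR a x = guessR b x := by
  rcases hx : part x with i | v
  · rw [← mem_triangle] at hx
    rw [guessR_triangle hx, guessR_triangle hx]
    congr 1
    refine Finset.sum_congr rfl fun u hu => h u ?_
    rw [Finset.mem_erase] at hu
    exact triangle_adj i x hx u hu.2 hu.1.symm
  · obtain rfl := (part_eq_inr_iff x v).1 hx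
    rw [guessR_copyRc, guessR_copyRc, rcGuess, rcGuess]
    congr 1
    refine Finset.sum_congr rfl fun w hw => ?_
    by_cases hadj : graphR.Adj (cloneOf v) (cloneOf w)
    · rw [Function.comp_apply, Function.comp_apply, h (copyRc w) hadj]
    · rw [rcComb_mul_rcCheck_apply_of_not_adj v w (Finset.mem_filter.1 hw).2 hadj, zero_mul,
        zero_mul]

/-- The thirteen linear conditions that hold if and only if all guesses are correct. -/
def syndrome : (Fin 10 × Fin 4 → Fin 3) →+ (Fin 9 → Fin 3) × (Fin 4 → Fin 3) where
  toFun a := (fun i => ∑ x ∈ triangle i, a x, rcCheck.mulVec (a ∘ copyRc))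
  map_zero' := by
    refine Prod.ext (funext fun i => ?_) ?_
    · simp
    · exact Matrix.mulVec_zero rcCheck
  map_add' a b := by
    refine Prod.ext (funext fun i => ?_) ?_
    · simp [Finset.sum_add_distrib]
    · exact Matrix.mulVec_add rcCheck (a ∘ copyRc) (b ∘ copyRc)

theorem forall_guessR_eq_iff (a : Fin 10 × Fin 4 → Fin 3) :
    (∀ x, guessR a x = a x) ↔ syndrome a = 0 := by
  -- The three players of a triangle are all correct under one and the same condition.
  have htri : ∀ i, ∀ x ∈ triangle i, guessR a x = a x ↔ ∑ u ∈ triangle i, a u = 0 :=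
    fun i x hx => by
      rw [guessR_triangle hx, ← Finset.add_sum_erase _ _ hx, neg_eq_iff_add_eq_zero, add_comm]
  have hne : ∀ i, ∃ x, x ∈ triangle i := by decide +kernel
  rw [Prod.ext_iff, funext_iff]
  change _ ↔ (∀ i, ∑ x ∈ triangle i, a x = 0) ∧ rcCheck.mulVec (a ∘ copyRc) = 0
  rw [← forall_rcGuess_eq_iff]
  refine ⟨fun h => ⟨fun i => ?_, fun v => ?_⟩, fun h x => ?_⟩
  · obtain ⟨x, hx⟩ := hne i
    exact (htri i x hx).1 (h x)
  · rw [← guessR_copyRc, h, Function.comp_apply]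
  · rcases hx : part x with i | v
    · rw [← mem_triangle] at hx
      exact (htri i x hx).2 (h.1 i)
    · obtain rfl := (part_eq_inr_iff x v).1 hx
      rw [guessR_copyRc, h.2, Function.comp_apply]

/-- A right inverse of the matrix of the parity conditions. -/
def rcCheckInv : Matrix (Fin 13) (Fin 4) (Fin 3) :=
  !![1, 0, 0, 0; 0, 0, 0, 0; 0, 0, 0, 0; 0, 0, 0, 0; 0, 0, 0, 0; 0, 0, 0, 0; 0, 0, 0, 0;
     0, 2, 2, 1; 0, 2, 1, 2; 0, 1, 2, 2; 0, 0, 0, 0; 0, 0, 0, 0; 0, 0, 0, 0]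

/-- Independence of the 13 conditions. The parts are disjoint, so they are solved separately: one
vertex of each triangle carries the prescribed sum, and on `R_c` the vertices `1`, `8`, `9`, `10`
suffice, whose columns in `rcCheck` form an invertible matrix. -/
theorem syndrome_surjective : Function.Surjective syndrome := by
  have hinv : rcCheck * rcCheckInv = 1 := by decide +kernel
  have hne : ∀ i, ∃ x, x ∈ triangle i := by decide +kernel
  choose p hp using hne
  rintro ⟨c, d⟩
  refine ⟨fun x => match part x with
    | .inl i => if x = p i then c i else 0
    | .inr v => rcCheckInv.mulVec d v, Prod.ext (funext fun i => ?_) ?_⟩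
  · change ∑ x ∈ triangle i, _ = c i
    rw [Finset.sum_congr rfl fun x hx => by rw [mem_triangle.1 hx], Finset.sum_ite_eq', if_pos (hp i)]
  · change rcCheck.mulVec _ = d
    conv_rhs => rw [← Matrix.one_mulVec d, ← hinv, ← Matrix.mulVec_mulVec]
    congr 1
    funext v
    simp only [Function.comp_apply, part_copyRc]

theorem card_ker_syndrome : Nat.card syndrome.ker = 3 ^ 27 := by
  have h := AddSubgroup.card_eq_card_quotient_mul_card_addSubgroup syndrome.ker
  rw [Nat.card_congr (QuotientAddGroup.quotientKerEquivOfSurjective _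
    syndrome_surjective).toEquiv] at h
  simp only [Nat.card_eq_fintype_card, Fintype.card_prod, Fintype.card_fun, Fintype.card_fin] at h ⊢
  omega

theorem ncard_winSet_eq {F : Strategy (blowup graphR 4) 3} (hF : ∀ a x, F.guess a x = guessR a x) :
    (winSet (blowup graphR 4) 3 F).ncard = 3 ^ 27 := by
  rw [← card_ker_syndrome, ← Nat.card_coe_set_eq]
  refine Nat.card_congr (Equiv.subtypeEquivRight fun a => ?_)
  simp only [winSet, Set.mem_ofPred_eq, hF, forall_guessR_eq_iff, AddMonoidHom.mem_ker]

theorem exists_strategy_blowup :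
    ∃ F : Strategy (blowup graphR 4) 3, ∀ a x, F.guess a x = guessR a x :=
  exists_strategy_guess_eq guessR guessR_congr

theorem exists_isCode_graphR :
    ∃ S : Finset (Fin 10 → Fin 4 → Fin 3), IsCode graphR S ∧ S.card = 3 ^ 27 := by
  obtain ⟨F, hF⟩ := exists_strategy_blowup
  obtain ⟨S, hS, hc⟩ := (isCode_winSet F (S := (Set.toFinite (winSet _ 3 F)).toFinset)
    (by simp)).exists_of_blowup
  exact ⟨S, hS, by rw [hc, ← Set.ncard_eq_toFinset_card, ncard_winSet_eq hF]⟩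

end GuessingGame

open GuessingGame
theorem mainTheorem4 :
    -- the asymptotic guessing number of `R` is `27/4`
    HasAsymptoticGuessingNumber graphR (27 / 4) ∧
    -- the fractional clique cover number of `R` is attained, and the bound it gives is `20/3`
    IsLeast (cliqueCoverWeights graphR) (fractionalCliqueCoverNumber graphR) ∧
    fractionalCliqueCoverBound graphR = 20 / 3 ∧
    fractionalCliqueCoverBound graphR ≠ 27 / 4 ∧
    -- the Shannon bound of `R` is `27/4`
    IsShannonBound graphR (27 / 4) ∧
    -- the strategy on `R(4)` over an alphabet of size `3`
    (∃ (T : Fin 9 → Finset (Fin 10 × Fin 4)) (φ : graphRc ↪g blowup graphR 4)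
        (F : Strategy (blowup graphR 4) 3),
      (∀ i, (blowup graphR 4).IsNClique 3 (T i)) ∧
      Pairwise (fun i j => Disjoint (T i) (T j)) ∧
      (∀ x, x ∈ Set.range φ ↔ ∀ i, x ∉ T i) ∧
      (∀ i, ∀ v ∈ T i, ∀ a, F.guess a v = -∑ u ∈ (T i).erase v, a u) ∧
      (∀ v a, F.guess a (φ v) = rcGuess (a ∘ φ) v) ∧
      winProb (blowup graphR 4) 3 F = (1 / 3) ^ 13) := by
  have hκ := fractionalCliqueCoverNumber_graphR
  have hbound : fractionalCliqueCoverBound graphR = 20 / 3 := by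
    rw [fractionalCliqueCoverBound, hκ, Fintype.card_fin]
    norm_num
  obtain ⟨S, hS, hc⟩ := exists_isCode_graphR
  have hne : S.Nonempty := Finset.card_pos.1 (by rw [hc]; positivity)
  have hα : 2 ≤ Fintype.card (Fin 4 → Fin 3) := by simp
  -- The alphabet `Fin 4 → Fin 3` has `3 ^ 4` letters and the code `3 ^ 27` words.
  have hlog : Real.logb (Fintype.card (Fin 4 → Fin 3)) S.card = 27 / 4 := by
    have h3 : Real.log 3 ≠ 0 := (Real.log_pos (by norm_num)).ne'
    rw [hc, Fintype.card_fun, Fintype.card_fin, Fintype.card_fin, ← Real.log_div_log, Nat.cast_pow,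
      Nat.cast_pow, Real.log_pow, Real.log_pow]
    push_cast
    field_simp
  have hle : ∀ x ∈ shannonValues graphR, x ≤ Real.logb (Fintype.card (Fin 4 → Fin 3)) S.card :=
    fun x hx => hlog ▸ shannonValues_graphR_le hx
  obtain ⟨F, hF⟩ := exists_strategy_blowup
  refine ⟨hlog ▸ hS.hasAsymptoticGuessingNumber hne hα hle, ?_, hbound, ?_,
    hlog ▸ hS.isShannonBound hne hα hle, triangle, copyRc, F, isNClique_triangle,
    fun i j hij => ?_, fun x => ?_, fun i v hv a => ?_, fun v a => ?_, ?_⟩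
  · rw [hκ]
    exact isLeast_cliqueCoverWeights_graphR
  · rw [hbound]
    norm_num
  · refine Finset.disjoint_left.2 fun x hi hj => hij ?_
    rw [mem_triangle] at hi hj
    exact Sum.inl_injective (hi.symm.trans hj)
  · simp only [mem_triangle, Set.mem_range, ← part_eq_inr_iff]
    rcases part x with i | v <;> simp
  · rw [hF, guessR_triangle hv]
  · rw [hF, guessR_copyRc]
  · rw [winProb, ncard_winSet_eq hF]
    simp only [Fintype.card_prod, Fintype.card_fin]
    norm_num
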